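/- Let $0\le k\le n$ and let $E\subset\mathbb R^n$ be the closure of a bounded Lipschitz domain. Write $\Lambda_k$ and $\Lambda^k=(\Lambda_k)^*$ for the spaces of $k$-vectors and $k$-covectors of $\mathbb R^n$, and $\mathcal H^k$ for the $k$-dimensional Hausdorff measure. An oriented $k$-rectifiable set is an $\mathcal H^k$-measurable $k$-rectifiable set $S\subset E$ with $0<\mathcal H^k(S)<\infty$, together with a $k$-vector field $\tau$ such that, up to an $\mathcal H^k$-null set, $S$ is a countable disjoint union $S_{\mathrm{reg}}$ of $\mathcal H^k$-measurable pieces of $\mathscr C^1$ embedded $k$-dimensional submanifolds, $\tau$ is continuous on $S_{\mathrm{reg}}$, and at every point of $S_{\mathrm{reg}}$ it is a simple $k$-vector of Euclidean norm one spanning the tangent space. For a continuous form $\omega\in\mathscr D_0^k(E)=\mathscr C^0(E,\Lambda^k)$ put $\int_S\omega=\int_S\langle\omega(x);\tau(x)\rangle\,d\mathcal H^k(x)$ and $T_S(\omega)=\mathcal H^k(S)^{-1}\int_S\omega$. Let $\mathscr A^k(E)$ be the set of all such averaging currents $T_S$, let $$\|\omega\|_0=\sup_{T\in\mathscr A^k(E)}|T(\omega)|,$$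 and, for a linear operator $L$ on $\mathscr D_0^k(E)$, let $\|L\|_{\mathrm{op}}=\sup_{\|\omega\|_0\neq0}\|L\omega\|_0/\|\omega\|_0$. The support $\operatorname{supp}T$ of a current $T$ is the complement in $E$ of the union of all open sets $A$ such that $T(\omega)=0$ for every $\omega\in\mathscr D_0^k(E)$ supported in $A$. Let $\mathscr V\subset\mathscr D_0^k(E)$ be a linear subspace of finite dimension $N$, let $T_1,\dots,T_M\in\mathscr A^k(E)$ be determining for $\mathscr V$ (that is, $\omega\in\mathscr V$ and $T_i(\omega)=0$ for all $i$ imply $\omega=0$), and let $w_1,\dots,w_M>0$. Put $(\omega,\theta)_{\mathcal T,w}=\sum_{i=1}^M w_iT_i(\omega)T_i(\theta)$, which is a scalar product on $\mathscr V$. Then for every $\omega\in\mathscr D_0^k(E)$ the function $\theta\mapsto(\omega-\theta,\omega-\theta)_{\mathcal T,w}$ has a unique minimizer $P\omega$ in $\mathscr V$, the operator $P$ is linear, and $\mathscr V$ has a basis that is orthonormal for $(\cdot,\cdot)_{\mathcal T,w}$. For every such orthonormal basis $\{\eta_1,\dots,\eta_N\}$ of $\mathscr V$, $$\|P\|_{\mathrm{op}}\le\mathscr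 M:=\sup_{T\in\mathscr A^k(E)}\sum_{i=1}^M w_i\Bigl|\sum_{h=1}^N T_i(\eta_h)T(\eta_h)\Bigr|<\infty .$$ If moreover $\mathcal H^k(\operatorname{supp}T_i\cap\operatorname{supp}T_j)=0$ for all $i\neq j$, then $\|P\|_{\mathrm{op}}=\mathscr M$. -/

import Mathlib

open MeasureTheory Topology Set
open scoped NNReal ENNReal

namespace IntegralCurrents

/-- Euclidean space `ℝⁿ`. -/
abbrev Space (n : ℕ) : Type := EuclideanSpace ℝ (Fin n)

/-- `Ω` is a bounded open set whose boundary is locally the graph of a Lipschitz function, with `Ω`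
lying on one side of it.  In the local coordinates given by the unit vector `v`, the point `x` has
height `⟪v, x⟫` over the point `x - ⟪v, x⟫ v` of the hyperplane orthogonal to `v`.
Connectedness is not required. -/
structure IsBoundedLipschitzDomain {n : ℕ} (Ω : Set (Space n)) : Prop where
  isOpen : IsOpen Ω
  isBounded : Bornology.IsBounded Ω
  boundary : ∀ p ∈ frontier Ω, ∃ v : Space n, ‖v‖ = 1 ∧ ∃ (L : ℝ≥0) (g : Space n → ℝ),
    LipschitzWith L g ∧ ∃ U ∈ 𝓝 p, ∀ x ∈ U,
      (x ∈ Ω ↔ g (x - (inner ℝ v x : ℝ) • v) < (inner ℝ v x : ℝ))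

/-- `Λ^k`: the alternating `k`-linear forms on `ℝⁿ`. -/
abbrev Covector (n k : ℕ) : Type := (Space n) [⋀^Fin k]→L[ℝ] ℝ

/-- `Λ_k`: the `k`-vectors of `ℝⁿ`, as the dual of the finite dimensional space `Λ^k`.
The duality pairing `⟨ω; τ⟩` is `τ ω`. -/
abbrev KVector (n k : ℕ) : Type := Covector n k →L[ℝ] ℝ

/-- The simple `k`-vector `v₁ ∧ ⋯ ∧ v_k`, characterised by
`⟨ω; v₁ ∧ ⋯ ∧ v_k⟩ = ω (v₁, …, v_k)`. -/
noncomputable def wedge {n k : ℕ} (v : Fin k → Space n) : KVector n k :=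
  ContinuousAlternatingMap.apply ℝ (Space n) ℝ v

/-- `τ` is a simple `k`-vector of Euclidean norm one whose factors form a basis of the subspace `W`.
Such a `k`-vector is, up to sign, the wedge product of an orthonormal basis of `W`
(the sign is needed only for `k = 0`). -/
def IsUnitSimpleSpanning {n k : ℕ} (τ : KVector n k) (W : Submodule ℝ (Space n)) : Prop :=
  ∃ (ε : ℝ) (v : Fin k → Space n), (ε = 1 ∨ ε = -1) ∧ Orthonormal ℝ v ∧
    Submodule.span ℝ (range v) = W ∧ τ = ε • wedge v

/-- `ψ`, restricted to the open set `V ⊆ ℝ^k`, is a `C¹` regular parametrization of a relatively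
open subset of `M`. -/
structure IsLocalParam {n k : ℕ} (M : Set (Space n)) (V : Set (Space k))
    (ψ : Space k → Space n) : Prop where
  isOpen_source : IsOpen V
  contDiffOn : ContDiffOn ℝ 1 ψ V
  injective_fderiv : ∀ y ∈ V, Function.Injective (fderiv ℝ ψ y)
  isEmbedding : IsEmbedding (fun y : V => ψ y)
  image_eq : ∃ U : Set (Space n), IsOpen U ∧ ψ '' V = M ∩ U

/-- `M` is a `C¹` embedded submanifold of `ℝⁿ` of dimension `k`. -/
def IsC1Submanifold {n : ℕ} (k : ℕ) (M : Set (Space n)) : Prop :=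
  ∀ p ∈ M, ∃ (V : Set (Space k)) (ψ : Space k → Space n), IsLocalParam M V ψ ∧ p ∈ ψ '' V

/-- `W` is the tangent space at `p` of the `k`-dimensional `C¹` submanifold `M`. -/
def IsTangentSpace {n : ℕ} (k : ℕ) (M : Set (Space n)) (p : Space n)
    (W : Submodule ℝ (Space n)) : Prop :=
  ∃ (V : Set (Space k)) (ψ : Space k → Space n), IsLocalParam M V ψ ∧
    ∃ y ∈ V, ψ y = p ∧ W = LinearMap.range (fderiv ℝ ψ y).toLinearMap

/-- `S` is `k`-rectifiable: up to an `ℋ^k`-null set it is covered by countably many Lipschitz images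
of `ℝ^k`. -/
def IsRectifiable {n : ℕ} (k : ℕ) (S : Set (Space n)) : Prop :=
  ∃ (N : Set (Space n)) (f : ℕ → Space k → Space n), μHE[k] N = 0 ∧
    (∀ j, ∃ L : ℝ≥0, LipschitzWith L (f j)) ∧ S ⊆ N ∪ ⋃ j, range (f j)

/-- `τ` is an orientation of the set `S`: there is a decomposition of `S` into an `ℋ^k`-null set and
a regular part `⋃ j, K j`, a countable disjoint union of `ℋ^k`-measurable pieces of `C¹`
submanifolds, such that `τ` is continuous on the regular part and is there a unit simple `k`-vector
spanning the tangent space. -/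
def IsOrientation {n k : ℕ} (S : Set (Space n)) (τ : Space n → KVector n k) : Prop :=
  ∃ (M K : ℕ → Set (Space n)),
    (∀ j, IsC1Submanifold k (M j)) ∧ (∀ j, K j ⊆ M j) ∧
    (∀ j, NullMeasurableSet (K j) μHE[k]) ∧ Pairwise (fun i j => Disjoint (K i) (K j)) ∧
    (⋃ j, K j) ⊆ S ∧ μHE[k] (S \ ⋃ j, K j) = 0 ∧
    ContinuousOn τ (⋃ j, K j) ∧
    ∀ j, ∀ x ∈ K j, ∃ W, IsTangentSpace k (M j) x W ∧ IsUnitSimpleSpanning (τ x) W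

/-- An oriented, `ℋ^k`-measurable, `k`-rectifiable subset of `E` with positive and finite
`ℋ^k`-measure.  (For sets of finite measure, `NullMeasurableSet` is Carathéodory measurability.) -/
structure OrientedRectifiable (n k : ℕ) (E : Set (Space n)) where
  carrier : Set (Space n)
  orient : Space n → KVector n k
  subset : carrier ⊆ E
  nullMeasurable : NullMeasurableSet carrier μHE[k]
  pos : 0 < μHE[k] carrier
  lt_top : μHE[k] carrier < ∞
  rectifiable : IsRectifiable k carrier
  orientation : IsOrientation carrier orient

/-- The test forms of order `k`: `k`-forms with continuous coefficients on the compact set `E`. -/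
abbrev TestForm (n k : ℕ) (E : TopologicalSpace.Compacts (Space n)) : Type :=
  C(E, Covector n k)

variable {n k : ℕ} {E : TopologicalSpace.Compacts (Space n)}

/-- The function `x ↦ ⟨ω(x); τ(x)⟩`; only its values on `S ⊆ E` matter, and off `E` the form is
extended by zero. -/
noncomputable def pairing (ω : TestForm n k E) (τ : Space n → KVector n k) (x : Space n) : ℝ :=
  τ x (Function.extend Subtype.val ω 0 x)

/-- `∫_S ω = ∫_S ⟨ω(x); τ(x)⟩ dℋ^k(x)`. -/
noncomputable def integral (S : OrientedRectifiable n k (E : Set (Space n)))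
    (ω : TestForm n k E) : ℝ :=
  ∫ x in S.carrier, pairing ω S.orient x ∂μHE[k]

theorem extend_apply (ω : TestForm n k E) (x : E) :
    Function.extend Subtype.val ω 0 (x : Space n) = ω x :=
  Subtype.val_injective.extend_apply _ _ _

theorem abs_le_of_isUnitSimpleSpanning {τ : KVector n k} {W : Submodule ℝ (Space n)}
    (h : IsUnitSimpleSpanning τ W) (α : Covector n k) : |τ α| ≤ ‖α‖ := by
  obtain ⟨ε, v, hε, hv, -, rfl⟩ := h
  have h1 : |wedge v α| ≤ ‖α‖ := by
    have := α.le_opNorm v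
    simpa [wedge, hv.1, Real.norm_eq_abs] using this
  rcases hε with rfl | rfl <;> simpa using h1

theorem integrableOn_pairing (S : OrientedRectifiable n k (E : Set (Space n)))
    (ω : TestForm n k E) : IntegrableOn (pairing ω S.orient) S.carrier μHE[k] := by
  obtain ⟨M, K, -, -, hK, -, hsub, hnull, hcont, hτ⟩ := S.orientation
  have hae : (⋃ j, K j : Set (Space n)) =ᵐ[μHE[k]] S.carrier := by
    refine (ae_le_set.2 ?_).antisymm (ae_le_set.2 hnull)
    rw [sdiff_eq_empty.2 hsub]; simp
  obtain ⟨R, hRsub, hRm, hRae⟩ :=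
    (NullMeasurableSet.iUnion hK).exists_measurable_subset_ae_eq
  refine IntegrableOn.congr_set_ae (t := R) ?_ (hRae.trans hae).symm
  have hωc : ContinuousOn (Function.extend Subtype.val ω 0 : Space n → Covector n k) E := by
    rw [continuousOn_iff_continuous_domRestrict]
    exact ω.continuous.congr fun x => (extend_apply ω x).symm
  have hRE : R ⊆ (E : Set (Space n)) := hRsub.trans (hsub.trans S.subset)
  have hRlt : μHE[k] R < ∞ := (measure_mono (hRsub.trans hsub)).trans_lt S.lt_top
  refine ⟨?_, HasFiniteIntegral.restrict_of_bounded ‖ω‖ hRlt ?_⟩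
  · exact ((hcont.mono hRsub).clm_apply (hωc.mono hRE)).aestronglyMeasurable hRm
  · refine (ae_restrict_iff' hRm).2 (Filter.Eventually.of_forall fun x hx => ?_)
    obtain ⟨j, hj⟩ := mem_iUnion.1 (hRsub hx)
    obtain ⟨W, -, hW⟩ := hτ j x hj
    refine (abs_le_of_isUnitSimpleSpanning hW _).trans ?_
    rw [extend_apply ω ⟨x, hRE hx⟩]
    exact ω.norm_coe_le_norm _

/-- The averaging current `T_S(ω) = ℋ^k(S)⁻¹ ∫_S ω`. -/
noncomputable def averagingCurrent (S : OrientedRectifiable n k (E : Set (Space n))) :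
    TestForm n k E →ₗ[ℝ] ℝ where
  toFun ω := (μHE[k] S.carrier).toReal⁻¹ * integral S ω
  map_add' ω θ := by
    have h : ∀ x ∈ S.carrier, pairing (ω + θ) S.orient x =
        pairing ω S.orient x + pairing θ S.orient x := fun x hx => by
      simp only [pairing]
      rw [extend_apply _ ⟨x, S.subset hx⟩, extend_apply _ ⟨x, S.subset hx⟩,
        extend_apply _ ⟨x, S.subset hx⟩]
      simp
    have h' : integral S (ω + θ) = integral S ω + integral S θ := by
      simp only [integral]
      rw [← integral_add (integrableOn_pairing S ω) (integrableOn_pairing S θ)]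
      refine integral_congr_ae ((ae_restrict_iff'₀ S.nullMeasurable).2
        (Filter.Eventually.of_forall h))
    rw [h', mul_add]
  map_smul' c ω := by
    have h : ∀ x ∈ S.carrier, pairing (c • ω) S.orient x = c * pairing ω S.orient x :=
      fun x hx => by
        simp only [pairing]
        rw [extend_apply _ ⟨x, S.subset hx⟩, extend_apply _ ⟨x, S.subset hx⟩]
        simp
    have h' : integral S (c • ω) = c * integral S ω := by
      simp only [integral]
      rw [← integral_const_mul]
      refine integral_congr_ae ((ae_restrict_iff'₀ S.nullMeasurable).2
        (Filter.Eventually.of_forall h))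
    rw [h', RingHom.id_apply, smul_eq_mul]
    ring

/-- The set `𝒜^k(E)` of all averaging currents. -/
def averagingCurrents (n k : ℕ) (E : TopologicalSpace.Compacts (Space n)) :
    Set (TestForm n k E →ₗ[ℝ] ℝ) :=
  range averagingCurrent

/-- The support of a current: the complement in `E` of the union of all open sets `A` such that `T`
vanishes on the test forms supported in `A`. -/
def currentSupport (T : TestForm n k E →ₗ[ℝ] ℝ) : Set (Space n) :=
  (E : Set (Space n)) \ ⋃₀ {A | IsOpen A ∧
    ∀ ω : TestForm n k E, Subtype.val '' tsupport ω ⊆ A → T ω = 0}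

/-- `‖ω‖₀ = sup_S ℋ^k(S)⁻¹ |∫_S ω|`, as an element of `[0, ∞]`. -/
noncomputable def norm0 (ω : TestForm n k E) : ℝ≥0∞ :=
  ⨆ S : OrientedRectifiable n k (E : Set (Space n)),
    ENNReal.ofReal ((μHE[k] S.carrier).toReal⁻¹ * |integral S ω|)

/-- `‖L‖_op = sup_{‖ω‖₀ ≠ 0} ‖L ω‖₀ / ‖ω‖₀`, as an element of `[0, ∞]`. -/
noncomputable def opNorm (L : TestForm n k E →ₗ[ℝ] TestForm n k E) : ℝ≥0∞ :=
  ⨆ (ω : TestForm n k E) (_ : norm0 ω ≠ 0), norm0 (L ω) / norm0 ω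

/-- The currents `T_i` are determining for `V`. -/
def IsDetermining {m : ℕ} (V : Submodule ℝ (TestForm n k E))
    (T : Fin m → TestForm n k E →ₗ[ℝ] ℝ) : Prop :=
  ∀ ω ∈ V, (∀ i, T i ω = 0) → ω = 0

/-- `(ω, θ)_{T,w} = ∑ i, w_i T_i(ω) T_i(θ)`. -/
noncomputable def discreteInner {m : ℕ} (T : Fin m → TestForm n k E →ₗ[ℝ] ℝ) (w : Fin m → ℝ)
    (ω θ : TestForm n k E) : ℝ :=
  ∑ i, w i * T i ω * T i θ

/-- `φ ∈ V` minimizes `θ ↦ (ω - θ, ω - θ)_{T,w}` over `V`. -/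
def IsLeastSquaresFit {m : ℕ} (V : Submodule ℝ (TestForm n k E))
    (T : Fin m → TestForm n k E →ₗ[ℝ] ℝ) (w : Fin m → ℝ) (ω φ : TestForm n k E) : Prop :=
  φ ∈ V ∧ ∀ θ ∈ V, discreteInner T w (ω - φ) (ω - φ) ≤ discreteInner T w (ω - θ) (ω - θ)

/-- The basis `η` of `V` is orthonormal for the discrete inner product. -/
def IsDiscreteOrthonormal {m N : ℕ} {V : Submodule ℝ (TestForm n k E)}
    (T : Fin m → TestForm n k E →ₗ[ℝ] ℝ) (w : Fin m → ℝ) (η : Module.Basis (Fin N) ℝ V) : Prop :=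
  ∀ g h, discreteInner T w (η g : TestForm n k E) (η h : TestForm n k E) = if g = h then 1 else 0

/-- `𝓜 = sup_{T' ∈ 𝒜^k(E)} ∑ i, w_i |∑ h, T_i(η_h) T'(η_h)|`, as an element of `[0, ∞]`. -/
noncomputable def fittingConstant {m N : ℕ} {V : Submodule ℝ (TestForm n k E)}
    (T : Fin m → TestForm n k E →ₗ[ℝ] ℝ) (w : Fin m → ℝ) (η : Module.Basis (Fin N) ℝ V) : ℝ≥0∞ :=
  ⨆ T' ∈ averagingCurrents n k E,
    ENNReal.ofReal (∑ i, w i * |∑ h, T i (η h : TestForm n k E) * T' (η h : TestForm n k E)|)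

end IntegralCurrents

/-! Write `c i = ∑ h, T i (η h) * T' (η h)`. The weighted least squares fit is the orthogonal
projection `P ω = ∑ h, (ω, η h) η h`, and exchanging sums gives `T' (P ω) = ∑ i, w i * T i ω * c i`
for every current `T'` (`apply_fourierSum`). Since each `T i` is itself an averaging current, `|T i
ω| ≤ ‖ω‖₀`, and the upper bound follows (`opNorm_fourierSum_le`).

For equality, one needs a form with `‖ω‖₀ ≤ 1` for which `T i ω` is nearly the sign of `c i`, for
all `i` at once (`exists_form_almost_sign`). An averaging current is carried by its support up to a
null set (`measure_diff_currentSupport`), so null overlaps of supports make the underlying sets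
disjoint up to null sets. Inner regularity then yields pairwise disjoint compact sets `K i` filling
almost all of each set, with continuous orientations on them. The requirements on `ω x` (comass at
most one, pairing close to one on `K i`) are convex and locally solvable by constants, so a
partition of unity produces `ω` (`exists_form_almost_dual`). The uncontrolled remainder costs at
most its measure. -/

namespace IntegralCurrents

/-! ### Covectors dual to the orientation, and their gluing into continuous forms. -/

section Forms

variable {n k : ℕ} {E : TopologicalSpace.Compacts (Space n)}

/-- The covector dual to a unit simple `k`-vector: it has comass at most one and pairs to one. -/
theorem IsUnitSimpleSpanning.exists_dual {τ : KVector n k} {W : Submodule ℝ (Space n)}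
    (h : IsUnitSimpleSpanning τ W) : ∃ α : Covector n k, ‖α‖ ≤ 1 ∧ τ α = 1 := by
  obtain ⟨ε, v, hε, hv, -, rfl⟩ := h
  have : Fact (Module.finrank ℝ (Space k) = k) := ⟨by simp⟩
  let b : OrthonormalBasis (Fin k) ℝ (Space k) := EuclideanSpace.basisFun (Fin k) ℝ
  let o : Orientation ℝ (Space k) (Fin k) := b.toBasis.orientation
  -- The dual covector is the volume form of `ℝ^k` pulled back along `x ↦ (⟪v i, x⟫)_i`. Bessel's
  -- inequality makes this map norm-nonincreasing and Hadamard's inequality bounds the volume form,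
  -- so the comass is at most one; the `v i` go to the standard basis, so the pairing is one.
  let f : Space n →ₗ[ℝ] Space k :=
    (WithLp.linearEquiv 2 ℝ (Fin k → ℝ)).symm.toLinearMap ∘ₗ
      LinearMap.pi fun i => (innerSL ℝ (v i)).toLinearMap
  have hf : ∀ x i, f x i = inner ℝ (v i) x := fun x i => rfl
  have hfx : ∀ x, ‖f x‖ ≤ ‖x‖ := fun x => by
    rw [← sq_le_sq₀ (norm_nonneg _) (norm_nonneg _), EuclideanSpace.norm_sq_eq]
    simpa [hf] using hv.sum_inner_products_le (s := Finset.univ) x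
  have hfv : (fun i => f (v i)) = b := by
    funext j
    ext i
    rw [hf, orthonormal_iff_ite.1 hv i j]
    simp [b]
  have hbound : ∀ u : Fin k → Space n,
      ‖(o.volumeForm.compLinearMap f) u‖ ≤ 1 * ∏ i, ‖u i‖ := fun u => by
    rw [one_mul, AlternatingMap.compLinearMap_apply, Real.norm_eq_abs]
    exact (o.abs_volumeForm_apply_le _).trans
      (Finset.prod_le_prod (fun i _ => norm_nonneg _) fun i _ => hfx _)
  let α : Covector n k := (o.volumeForm.compLinearMap f).mkContinuous 1 hbound
  have hα : ‖α‖ ≤ 1 := AlternatingMap.mkContinuous_norm_le _ zero_le_one _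
  have hαv : wedge v α = 1 := by
    change o.volumeForm (fun i => f (v i)) = 1
    rw [hfv, o.volumeForm_robust b rfl]
    exact b.toBasis.det_self
  rcases hε with rfl | rfl
  · exact ⟨α, hα, by simpa using hαv⟩
  · exact ⟨-α, by simpa using hα, by simpa using hαv⟩

/-- The pieces in an orientation are only null measurable; discarding a null set leaves a Borel set,
to which inner regularity by compact sets applies. -/
theorem OrientedRectifiable.exists_measurable_regular
    (S : OrientedRectifiable n k (E : Set (Space n))) :
    ∃ R ⊆ S.carrier, MeasurableSet R ∧ μHE[k] (S.carrier \ R) = 0 ∧ ContinuousOn S.orient R ∧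
      ∀ x ∈ R, ∃ W, IsUnitSimpleSpanning (S.orient x) W := by
  obtain ⟨M, K, -, -, hK, -, hsub, hnull, hcont, hτ⟩ := S.orientation
  obtain ⟨R, hRsub, hRm, hRae⟩ :=
    (NullMeasurableSet.iUnion hK).exists_measurable_subset_ae_eq
  refine ⟨R, hRsub.trans hsub, hRm, ?_, hcont.mono hRsub, fun x hx => ?_⟩
  · refine measure_mono_null (t := (S.carrier \ ⋃ j, K j) ∪ ((⋃ j, K j) \ R)) ?_
      (measure_union_null hnull (ae_le_set.1 hRae.symm.le))
    intro x hx
    by_cases hxK : x ∈ ⋃ j, K j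
    · exact Or.inr ⟨hxK, hx.2⟩
    · exact Or.inl ⟨hx.1, hxK⟩
  · obtain ⟨j, hj⟩ := mem_iUnion.1 (hRsub hx)
    obtain ⟨W, -, hW⟩ := hτ j x hj
    exact ⟨W, hW⟩

/-- A form of comass at most one that is almost dual to given continuous fields of `k`-vectors on
disjoint closed sets and vanishes on a further closed set. -/
theorem exists_form_almost_dual {ι : Type*} [Finite ι] (K : ι → Set (Space n))
    (hK : ∀ i, IsClosed (K i)) (hdisj : Pairwise fun i j => Disjoint (K i) (K j))
    (τ : ι → Space n → KVector n k) (hτ : ∀ i, ContinuousOn (τ i) (K i))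
    (hdual : ∀ i, ∀ x ∈ K i, ∃ α : Covector n k, ‖α‖ ≤ 1 ∧ τ i x α = 1)
    {F : Set (Space n)} (hF : IsClosed F) (hFK : ∀ i, Disjoint F (K i)) {c : ℝ} (hc : c < 1) :
    ∃ ω : TestForm n k E, (∀ x, ‖ω x‖ ≤ 1) ∧ (∀ i, ∀ x : E, (x : Space n) ∈ K i →
      c ≤ τ i x (ω x)) ∧ ∀ x : E, (x : Space n) ∈ F → ω x = 0 := by
  -- All constraints on the value at a single point, each of them convex.
  let t : E → Set (Covector n k) := fun x =>
    {α | ‖α‖ ≤ 1 ∧ (∀ i, (x : Space n) ∈ K i → c ≤ τ i x α) ∧ ((x : Space n) ∈ F → α = 0)}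
  have ht : ∀ x, Convex ℝ (t x) := by
    rintro x α ⟨hα, hαK, hαF⟩ β ⟨hβ, hβK, hβF⟩ a b ha hb hab
    refine ⟨?_, fun i hi => ?_, fun hx => by simp [hαF hx, hβF hx]⟩
    · have := convex_closedBall (0 : Covector n k) 1 (mem_closedBall_zero_iff.2 hα)
        (mem_closedBall_zero_iff.2 hβ) ha hb hab
      exact mem_closedBall_zero_iff.1 this
    · have h1 := mul_le_mul_of_nonneg_left (hαK i hi) ha
      have h2 := mul_le_mul_of_nonneg_left (hβK i hi) hb
      have h3 : c = a * c + b * c := by rw [← add_mul, hab, one_mul]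
      simp only [map_add, map_smul, smul_eq_mul]
      linarith
  have hout : ∀ {C : Set (Space n)}, IsClosed C → ∀ {x : E}, (x : Space n) ∉ C →
      ∀ᶠ y : E in 𝓝 x, (y : Space n) ∉ C := fun {C} hC {x} hx =>
    continuous_subtype_val.continuousAt.eventually (hC.isOpen_compl.mem_nhds hx)
  -- A partition of unity reduces the claim to constant local solutions. At a point of `K i` the
  -- dual covector works nearby: the pairing is `1 > c` there and `τ i` is continuous on `K i`,
  -- while `F` and the other `K j` stay at a distance. Away from all `K j`, zero works.
  obtain ⟨ω, hω⟩ := exists_continuous_forall_mem_convex_of_local_const ht fun x => by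
    by_cases hx : ∃ i, (x : Space n) ∈ K i
    · obtain ⟨i, hi⟩ := hx
      obtain ⟨α, hα, hαx⟩ := hdual i x hi
      refine ⟨α, ?_⟩
      have h1 : ∀ᶠ y : E in 𝓝 x, ∀ j, j ≠ i → (y : Space n) ∉ K j :=
        Filter.eventually_all.2 fun j => by
          by_cases hj : j = i
          · exact Filter.Eventually.of_forall fun y h => absurd hj h
          · exact (hout (hK j) (disjoint_right.1 (hdisj hj) hi)).mono fun y hy _ => hy
      have h2 : ∀ᶠ y : E in 𝓝 x, (y : Space n) ∈ K i → c ≤ τ i y α := by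
        have hcont : ContinuousWithinAt (fun y => τ i y α) (K i) x :=
          (hτ i x hi).clm_apply continuousWithinAt_const
        have := eventually_nhdsWithin_iff.1
          (hcont.eventually (lt_mem_nhds (show c < τ i x α by rwa [hαx])))
        exact (continuous_subtype_val.continuousAt.eventually this).mono
          fun y hy hyK => (hy hyK).le
      filter_upwards [h1, h2, hout hF (disjoint_right.1 (hFK i) hi)] with y hy1 hy2 hy3
      refine ⟨hα, fun j hj => ?_, fun h => absurd h hy3⟩
      by_cases hji : j = i
      · subst hji
        exact hy2 hj
      · exact absurd hj (hy1 j hji)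
    · push Not at hx
      refine ⟨0, ?_⟩
      have h1 : ∀ᶠ y : E in 𝓝 x, ∀ j, (y : Space n) ∉ K j :=
        Filter.eventually_all.2 fun j => hout (hK j) (hx j)
      filter_upwards [h1] with y hy
      exact ⟨by simp, fun j hj => absurd hj (hy j), fun _ => rfl⟩
  exact ⟨ω, fun x => (hω x).1, fun i x hx => (hω x).2.1 i hx, fun x hx => (hω x).2.2 hx⟩

end Forms

/-! ### Averaging currents: mass bounds, supports, and forms with prescribed signs. -/

section Currents

variable {n k : ℕ} {E : TopologicalSpace.Compacts (Space n)}

theorem OrientedRectifiable.measureReal_pos (S : OrientedRectifiable n k (E : Set (Space n))) :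
    0 < (μHE[k] S.carrier).toReal :=
  ENNReal.toReal_pos S.pos.ne' S.lt_top.ne

theorem OrientedRectifiable.ae_abs_pairing_le (S : OrientedRectifiable n k (E : Set (Space n)))
    (ω : TestForm n k E) :
    ∀ᵐ x ∂μHE[k].restrict S.carrier, |pairing ω S.orient x| ≤
      ‖Function.extend Subtype.val ω 0 x‖ := by
  obtain ⟨R, -, -, hRnull, -, hR⟩ := S.exists_measurable_regular
  rw [ae_restrict_iff'₀ S.nullMeasurable]
  have : ∀ᵐ x ∂μHE[k], x ∉ S.carrier \ R := measure_eq_zero_iff_ae_notMem.1 hRnull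
  filter_upwards [this] with x hx hxS
  obtain ⟨W, hW⟩ := hR x (by_contra fun h => hx ⟨hxS, h⟩)
  exact abs_le_of_isUnitSimpleSpanning hW _

theorem abs_integral_le (S : OrientedRectifiable n k (E : Set (Space n))) (ω : TestForm n k E)
    {C : ℝ} (hC : ∀ x, ‖ω x‖ ≤ C) : |integral S ω| ≤ C * (μHE[k] S.carrier).toReal := by
  refine norm_setIntegral_le_of_norm_le_const_ae (f := pairing ω S.orient) S.lt_top ?_
  have h1 : ∀ᵐ x ∂μHE[k].restrict S.carrier, x ∈ S.carrier := ae_restrict_mem₀ S.nullMeasurable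
  filter_upwards [S.ae_abs_pairing_le ω, h1] with x hx hxS
  refine hx.trans ?_
  rw [extend_apply ω ⟨x, S.subset hxS⟩]
  exact hC _

theorem abs_averagingCurrent_le (S : OrientedRectifiable n k (E : Set (Space n)))
    (ω : TestForm n k E) {C : ℝ} (hC : ∀ x, ‖ω x‖ ≤ C) : |averagingCurrent S ω| ≤ C := by
  change |(μHE[k] S.carrier).toReal⁻¹ * integral S ω| ≤ C
  rw [abs_mul, abs_inv, abs_of_pos S.measureReal_pos, inv_mul_le_iff₀ S.measureReal_pos, mul_comm]
  exact abs_integral_le S ω hC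

/-- Lower bound for the integral of a form of comass at most one that is supported in `A` and whose
pairing with the orientation is at least `c` on `K`. -/
theorem le_integral (S : OrientedRectifiable n k (E : Set (Space n))) (ω : TestForm n k E)
    (hω : ∀ x, ‖ω x‖ ≤ 1) {K A : Set (Space n)} (hK : MeasurableSet K) (hA : MeasurableSet A)
    (hKS : K ⊆ S.carrier) (hKA : K ⊆ A) {c : ℝ} (hc : ∀ x ∈ K, c ≤ pairing ω S.orient x)
    (hωA : ∀ x : E, (x : Space n) ∉ A → ω x = 0) :
    c * (μHE[k] K).toReal - (μHE[k] ((S.carrier ∩ A) \ K)).toReal ≤ integral S ω := by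
  have hint := integrableOn_pairing S ω
  have hlt : ∀ {B : Set (Space n)}, B ⊆ S.carrier → μHE[k] B < ∞ := fun h =>
    (measure_mono h).trans_lt S.lt_top
  have hSA : NullMeasurableSet ((S.carrier ∩ A) \ K) μHE[k] :=
    (S.nullMeasurable.inter hA.nullMeasurableSet).diff hK.nullMeasurableSet
  have h1 : ∫ x in S.carrier ∩ A, pairing ω S.orient x ∂μHE[k] = integral S ω := by
    refine (setIntegral_eq_of_subset_of_ae_sdiff_eq_zero S.nullMeasurable inter_subset_left
      (Filter.Eventually.of_forall fun x hx => ?_)).symm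
    have hxA : x ∉ A := fun h => hx.2 ⟨hx.1, h⟩
    rw [pairing, extend_apply ω ⟨x, S.subset hx.1⟩, hωA ⟨x, S.subset hx.1⟩ hxA, map_zero]
  have h2 := setIntegral_union₀ (μ := μHE[k]) (f := pairing ω S.orient) (s := K)
    (t := (S.carrier ∩ A) \ K) disjoint_sdiff_right.aedisjoint hSA
    (hint.mono_set hKS) (hint.mono_set (sdiff_subset.trans inter_subset_left))
  rw [union_sdiff_cancel (subset_inter hKS hKA), h1] at h2
  have h3 : c * (μHE[k] K).toReal ≤ ∫ x in K, pairing ω S.orient x ∂μHE[k] :=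
    setIntegral_ge_of_const_le_real hK (hlt hKS).ne hc (hint.mono_set hKS)
  -- Nothing is known about the sign of the pairing off `K`, so the remainder is only bounded by its
  -- measure.
  have h4 : |∫ x in (S.carrier ∩ A) \ K, pairing ω S.orient x ∂μHE[k]| ≤
      1 * (μHE[k] ((S.carrier ∩ A) \ K)).toReal := by
    have hsub : (S.carrier ∩ A) \ K ⊆ S.carrier := sdiff_subset.trans inter_subset_left
    refine norm_setIntegral_le_of_norm_le_const_ae (f := pairing ω S.orient) (hlt hsub) ?_
    filter_upwards [ae_restrict_of_ae_restrict_of_subset hsub (S.ae_abs_pairing_le ω),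
      ae_restrict_mem₀ hSA] with x hx hxS
    refine hx.trans ?_
    rw [extend_apply ω ⟨x, S.subset (hsub hxS)⟩]
    exact hω _
  have := neg_abs_le (∫ x in (S.carrier ∩ A) \ K, pairing ω S.orient x ∂μHE[k])
  linarith

/-- A subset of finite measure is exhausted from inside by compact sets. -/
theorem exists_isCompact_measure_diff_le {B : Set (Space n)} (hB : MeasurableSet B)
    (hBlt : μHE[k] B < ∞) {δ : ℝ} (hδ : 0 < δ) :
    ∃ K ⊆ B, IsCompact K ∧ (μHE[k] (B \ K)).toReal ≤ δ := by
  -- For `k < n` the measure `ℋ^k` is not locally finite; its restriction to `B` is finite, hence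
  -- inner regular.
  have : IsFiniteMeasure ((μHE[k] : Measure (Space n)).restrict B) :=
    ⟨by rwa [Measure.restrict_apply_univ]⟩
  obtain ⟨K, hKB, hK, hlt⟩ := hB.exists_isCompact_sdiff_lt (μ := μHE[k].restrict B)
    (measure_ne_top _ _) (ENNReal.ofReal_pos.2 hδ).ne'
  refine ⟨K, hKB, hK, ENNReal.toReal_le_of_le_ofReal hδ.le ?_⟩
  rw [Measure.restrict_apply (hB.diff hK.measurableSet), inter_eq_left.2 sdiff_subset] at hlt
  exact hlt.le

/-- If the averaging current of `S` vanishes on the forms supported in an open set `A`, then `S`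
meets `A` in a null set. -/
theorem measure_inter_eq_zero_of_averagingCurrent (S : OrientedRectifiable n k (E : Set (Space n)))
    {A : Set (Space n)} (hA : IsOpen A)
    (h : ∀ ω : TestForm n k E, Subtype.val '' tsupport ω ⊆ A → averagingCurrent S ω = 0) :
    μHE[k] (S.carrier ∩ A) = 0 := by
  obtain ⟨R, hRS, hRm, hRnull, hRc, hR⟩ := S.exists_measurable_regular
  have hsub : S.carrier ∩ A ⊆ (S.carrier \ R) ∪ (R ∩ A) := fun x hx => by
    by_cases hxR : x ∈ R
    · exact Or.inr ⟨hxR, hx.2⟩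
    · exact Or.inl ⟨hx.1, hxR⟩
  suffices hRA : μHE[k] (R ∩ A) = 0 from
    measure_mono_null hsub (measure_union_null hRnull hRA)
  by_contra hne
  have hlt : μHE[k] (R ∩ A) < ∞ :=
    (measure_mono (inter_subset_left.trans hRS)).trans_lt S.lt_top
  have hpos : 0 < (μHE[k] (R ∩ A)).toReal := ENNReal.toReal_pos hne hlt.ne
  -- With `a = ℋ^k(R ∩ A)`, losing at most `a / 4` outside `K` and pairing at least `1 / 2` on `K`
  -- give an integral of at least `3a/8 - a/4 > 0`, contradicting the vanishing of the current.
  obtain ⟨K, hKsub, hK, hKδ⟩ := exists_isCompact_measure_diff_le (hRm.inter hA.measurableSet) hlt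
    (show 0 < (μHE[k] (R ∩ A)).toReal / 4 by positivity)
  -- The support of a form is closed, so vanishing off `A` would not place it inside `A`; vanishing
  -- off `B`, with `closure B ⊆ A`, does.
  obtain ⟨B, hBo, hKB, hBA⟩ := normal_exists_closure_subset hK.isClosed hA
    (hKsub.trans inter_subset_right)
  obtain ⟨ω, hω1, hωK, hωB⟩ := exists_form_almost_dual (E := E) (fun _ : Unit => K)
    (fun _ => hK.isClosed) (fun i j hij => absurd (Subsingleton.elim i j) hij)
    (fun _ => S.orient) (fun _ => hRc.mono (hKsub.trans inter_subset_left))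
    (fun _ x hx => by
      obtain ⟨W, hW⟩ := hR x (hKsub hx).1
      exact hW.exists_dual) (F := Bᶜ) hBo.isClosed_compl
    (fun _ => disjoint_compl_left_iff_subset.2 hKB) (show (1 / 2 : ℝ) < 1 by norm_num)
  have hsupp : Subtype.val '' tsupport ω ⊆ closure B := by
    rw [image_subset_iff]
    refine closure_minimal (fun x hx => ?_) (isClosed_closure.preimage continuous_subtype_val)
    exact subset_closure (by_contra fun hxB => hx (hωB x hxB))
  have hzero : integral S ω = 0 :=
    (mul_eq_zero.1 (h ω (hsupp.trans hBA))).resolve_left (inv_pos.2 S.measureReal_pos).ne'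
  have hKS : K ⊆ S.carrier := hKsub.trans (inter_subset_left.trans hRS)
  have hle := le_integral S ω hω1 hK.measurableSet hA.measurableSet hKS
    (hKsub.trans inter_subset_right) (c := 1 / 2) (fun x hx => by
      rw [pairing, extend_apply ω ⟨x, S.subset (hKS hx)⟩]
      exact hωK () ⟨x, S.subset (hKS hx)⟩ hx)
    (fun x hx => hωB x fun hxB => hx (hBA (subset_closure hxB)))
  have hdiff : μHE[k] ((S.carrier ∩ A) \ K) ≤ μHE[k] ((R ∩ A) \ K) := by
    have : (S.carrier ∩ A) \ K ⊆ (S.carrier \ R) ∪ ((R ∩ A) \ K) := fun x hx => by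
      rcases hsub hx.1 with h | h
      · exact Or.inl h
      · exact Or.inr ⟨h, hx.2⟩
    refine (measure_mono this).trans ((measure_union_le _ _).trans ?_)
    rw [hRnull, zero_add]
  have hdiff' := ENNReal.toReal_mono (measure_mono sdiff_subset |>.trans_lt hlt).ne hdiff
  have hsum : (μHE[k] (R ∩ A)).toReal ≤
      (μHE[k] K).toReal + (μHE[k] ((R ∩ A) \ K)).toReal := by
    have := measureReal_union_le (μ := μHE[k]) K ((R ∩ A) \ K)
    rwa [union_sdiff_cancel hKsub] at this
  linarith

/-- The union of open sets defining the support may be uncountable; by the Lindelöf property a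
countable subfamily has the same union, so the null sets add up to a null set. -/
theorem measure_diff_currentSupport (S : OrientedRectifiable n k (E : Set (Space n))) :
    μHE[k] (S.carrier \ currentSupport (averagingCurrent S)) = 0 := by
  obtain ⟨𝒜, h𝒜c, h𝒜, heq⟩ := TopologicalSpace.isOpen_sUnion_countable
    {A | IsOpen A ∧ ∀ ω : TestForm n k E, Subtype.val '' tsupport ω ⊆ A →
      averagingCurrent S ω = 0} fun A hA => hA.1
  refine measure_mono_null (t := ⋃ A ∈ 𝒜, S.carrier ∩ A) (fun x hx => ?_)
    ((measure_biUnion_null_iff h𝒜c).2 fun A hA =>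
      measure_inter_eq_zero_of_averagingCurrent S (h𝒜 hA).1 (h𝒜 hA).2)
  have hx2 : x ∈ ⋃₀ 𝒜 := by
    rw [heq]
    exact by_contra fun h => hx.2 ⟨S.subset hx.1, h⟩
  obtain ⟨A, hA, hxA⟩ := hx2
  exact mem_biUnion hA ⟨hx.1, hxA⟩

/-- If the supports of the currents overlap in null sets only, there is a form of comass at most one
on which the currents almost attain prescribed signs. -/
theorem exists_form_almost_sign {ι : Type*} [Finite ι]
    (S : ι → OrientedRectifiable n k (E : Set (Space n)))
    (hS : ∀ i j, i ≠ j → μHE[k] (currentSupport (averagingCurrent (S i)) ∩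
      currentSupport (averagingCurrent (S j))) = 0)
    (s : ι → ℝ) (hs : ∀ i, s i = 1 ∨ s i = -1) {ε : ℝ} (hε : 0 < ε) :
    ∃ ω : TestForm n k E, (∀ x, ‖ω x‖ ≤ 1) ∧ ∀ i, 1 - ε ≤ s i * averagingCurrent (S i) ω := by
  choose R hRS hRm hRnull hRc hR using fun i => (S i).exists_measurable_regular
  have hRR : ∀ i j, i ≠ j → μHE[k] (R i ∩ R j) = 0 := fun i j hij => by
    refine measure_mono_null (fun x hx => ?_) (measure_union_null (measure_union_null
      (measure_diff_currentSupport (S i)) (measure_diff_currentSupport (S j))) (hS i j hij))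
    by_cases h1 : x ∈ currentSupport (averagingCurrent (S i))
    · by_cases h2 : x ∈ currentSupport (averagingCurrent (S j))
      · exact Or.inr ⟨h1, h2⟩
      · exact Or.inl (Or.inr ⟨hRS j hx.2, h2⟩)
    · exact Or.inl (Or.inl ⟨hRS i hx.1, h1⟩)
  -- Removing the null overlaps turns almost everywhere disjointness into disjointness, as needed
  -- for the compact sets chosen inside.
  let Q : ι → Set (Space n) := fun i => R i \ ⋃ j ∈ {j | j ≠ i}, R j
  have hQm : ∀ i, MeasurableSet (Q i) := fun i =>
    (hRm i).diff (MeasurableSet.biUnion (to_countable _) fun j _ => hRm j)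
  have hQS : ∀ i, Q i ⊆ (S i).carrier := fun i => sdiff_subset.trans (hRS i)
  have hQnull : ∀ i, μHE[k] ((S i).carrier \ Q i) = 0 := fun i => by
    refine measure_mono_null (t := ((S i).carrier \ R i) ∪ ⋃ j ∈ {j | j ≠ i}, R i ∩ R j)
      (fun x hx => ?_) (measure_union_null (hRnull i)
        ((measure_biUnion_null_iff (to_countable _)).2 fun j hj => hRR i j (Ne.symm hj)))
    by_cases hxR : x ∈ R i
    · have : x ∈ ⋃ j ∈ {j | j ≠ i}, R j := by_contra fun h => hx.2 ⟨hxR, h⟩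
      obtain ⟨j, hj, hxj⟩ := mem_iUnion₂.1 this
      exact Or.inr (mem_iUnion₂.2 ⟨j, hj, hxR, hxj⟩)
    · exact Or.inl ⟨hx.1, hxR⟩
  -- The budget `ε` splits into three losses of `ε / 3` relative to `ℋ^k(S i)`: the mass missing
  -- from `K i`, the defect of the pairing on `K i`, and the uncontrolled integral over the rest.
  choose K hKQ hK hKδ using fun i => exists_isCompact_measure_diff_le (hQm i)
    ((measure_mono (hQS i)).trans_lt (S i).lt_top)
    (show 0 < ε / 3 * (μHE[k] (S i).carrier).toReal from
      mul_pos (by positivity) (S i).measureReal_pos)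
  have hKR : ∀ i, K i ⊆ R i := fun i => (hKQ i).trans sdiff_subset
  have hKS : ∀ i, K i ⊆ (S i).carrier := fun i => (hKQ i).trans (hQS i)
  obtain ⟨ω, hω1, hωK, -⟩ := exists_form_almost_dual (E := E) K (fun i => (hK i).isClosed)
    (fun i j hij => disjoint_left.2 fun x hxi hxj =>
      (hKQ i hxi).2 (mem_iUnion₂.2 ⟨j, hij.symm, hKR j hxj⟩))
    -- The prescribed sign is absorbed into the orientation.
    (fun i x => s i • (S i).orient x) (fun i => ((hRc i).mono (hKR i)).const_smul (s i))
    (fun i x hx => by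
      obtain ⟨W, hW⟩ := hR i x (hKR i hx)
      obtain ⟨α, hα, hαx⟩ := hW.exists_dual
      rcases hs i with h | h
      · exact ⟨α, hα, by simp [h, hαx]⟩
      · exact ⟨-α, by simpa using hα, by simp [h, hαx]⟩)
    (F := ∅) isClosed_empty (fun i => empty_disjoint _) (show 1 - ε / 3 < 1 by linarith)
  refine ⟨ω, hω1, fun i => ?_⟩
  have hle := le_integral (S i) (s i • ω)
    (fun x => by
      have h : ‖s i‖ = 1 := by rcases hs i with h | h <;> simp [h]
      rw [ContinuousMap.smul_apply, norm_smul, h, one_mul]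
      exact hω1 x)
    (hK i).measurableSet MeasurableSet.univ (hKS i) (subset_univ _) (c := 1 - ε / 3)
    (fun x hx => by
      rw [pairing, extend_apply _ ⟨x, (S i).subset (hKS i hx)⟩]
      simpa using hωK i ⟨x, (S i).subset (hKS i hx)⟩ hx)
    (fun x hx => absurd (mem_univ _) hx)
  rw [inter_univ] at hle
  have hdiff : μHE[k] ((S i).carrier \ K i) ≤ μHE[k] (Q i \ K i) := by
    have : (S i).carrier \ K i ⊆ ((S i).carrier \ Q i) ∪ (Q i \ K i) := fun x hx => by
      by_cases h : x ∈ Q i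
      · exact Or.inr ⟨h, hx.2⟩
      · exact Or.inl ⟨hx.1, h⟩
    refine (measure_mono this).trans ((measure_union_le _ _).trans ?_)
    rw [hQnull, zero_add]
  have hdiff' := (ENNReal.toReal_mono (measure_mono (sdiff_subset.trans (hQS i)) |>.trans_lt
    (S i).lt_top).ne hdiff).trans (hKδ i)
  have hsum : (μHE[k] (S i).carrier).toReal ≤
      (μHE[k] (K i)).toReal + (μHE[k] ((S i).carrier \ K i)).toReal := by
    have := measureReal_union_le (μ := μHE[k]) (K i) ((S i).carrier \ K i)
    rwa [union_sdiff_cancel (hKS i)] at this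
  have hKle : (μHE[k] (K i)).toReal ≤ (μHE[k] (S i).carrier).toReal :=
    ENNReal.toReal_mono (S i).lt_top.ne (measure_mono (hKS i))
  have hsmul : s i * averagingCurrent (S i) ω = averagingCurrent (S i) (s i • ω) := by
    rw [map_smul, smul_eq_mul]
  rw [hsmul]
  change 1 - ε ≤ (μHE[k] (S i).carrier).toReal⁻¹ * integral (S i) (s i • ω)
  rw [← div_eq_inv_mul, le_div_iff₀ (S i).measureReal_pos]
  nlinarith [(S i).measureReal_pos]

end Currents

/-! ### The discrete least squares projection. -/

section LeastSquares

variable {n k m N : ℕ} {E : TopologicalSpace.Compacts (Space n)}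

/-- The weighted sampling operator `ω ↦ (√w_i T_i(ω))_i`. -/
noncomputable def sampling (T : Fin m → TestForm n k E →ₗ[ℝ] ℝ) (w : Fin m → ℝ) :
    TestForm n k E →ₗ[ℝ] EuclideanSpace ℝ (Fin m) :=
  (WithLp.linearEquiv 2 ℝ (Fin m → ℝ)).symm.toLinearMap ∘ₗ
    LinearMap.pi fun i => √(w i) • T i

theorem sampling_apply (T : Fin m → TestForm n k E →ₗ[ℝ] ℝ) (w : Fin m → ℝ) (ω : TestForm n k E)
    (i : Fin m) : sampling T w ω i = √(w i) * T i ω := rfl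

variable {T : Fin m → TestForm n k E →ₗ[ℝ] ℝ} {w : Fin m → ℝ} {V : Submodule ℝ (TestForm n k E)}

theorem discreteInner_eq_inner (hw : ∀ i, 0 < w i) (ω θ : TestForm n k E) :
    discreteInner T w ω θ = inner ℝ (sampling T w ω) (sampling T w θ) := by
  simp only [discreteInner, PiLp.inner_apply, sampling_apply, RCLike.inner_apply, conj_trivial]
  refine Finset.sum_congr rfl fun i _ => ?_
  have := Real.mul_self_sqrt (hw i).le
  linear_combination (-(T i ω * T i θ)) * this

theorem discreteInner_self (hw : ∀ i, 0 < w i) (ω : TestForm n k E) :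
    discreteInner T w ω ω = ‖sampling T w ω‖ ^ 2 := by
  rw [discreteInner_eq_inner hw, real_inner_self_eq_norm_sq]

theorem eq_zero_of_sampling_eq_zero (hw : ∀ i, 0 < w i) (hdet : IsDetermining V T)
    {ω : TestForm n k E} (hω : ω ∈ V) (h : sampling T w ω = 0) : ω = 0 := by
  refine hdet ω hω fun i => ?_
  have hi : √(w i) * T i ω = 0 := by rw [← sampling_apply, h]; rfl
  exact (mul_eq_zero.1 hi).resolve_left (Real.sqrt_pos.2 (hw i)).ne'

/-- Sampling embeds `V` in `ℝ^m` and turns the discrete product into the Euclidean one, so an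
orthonormal basis of the image can be pulled back. -/
theorem exists_isDiscreteOrthonormal [FiniteDimensional ℝ V] (hw : ∀ i, 0 < w i)
    (hdet : IsDetermining V T) :
    ∃ η : Module.Basis (Fin (Module.finrank ℝ V)) ℝ V, IsDiscreteOrthonormal T w η := by
  let A : V →ₗ[ℝ] EuclideanSpace ℝ (Fin m) := sampling T w ∘ₗ V.subtype
  have hA : Function.Injective A := fun x y hxy =>
    Subtype.ext (sub_eq_zero.1 (eq_zero_of_sampling_eq_zero hw hdet (V.sub_mem x.2 y.2)
      (by rw [map_sub]; exact sub_eq_zero.2 hxy)))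
  let e : V ≃ₗ[ℝ] LinearMap.range A := LinearEquiv.ofInjective A hA
  have hfin : Module.finrank ℝ (LinearMap.range A) = Module.finrank ℝ V := e.symm.finrank_eq
  let b : OrthonormalBasis (Fin (Module.finrank ℝ V)) ℝ (LinearMap.range A) :=
    (stdOrthonormalBasis ℝ (LinearMap.range A)).reindex (finCongr hfin)
  refine ⟨b.toBasis.map e.symm, fun g h => ?_⟩
  have hb : ∀ g, sampling T w ((b.toBasis.map e.symm g : V) : TestForm n k E) = b g := fun g => by
    change ((e (b.toBasis.map e.symm g) : LinearMap.range A) : EuclideanSpace ℝ (Fin m)) = b g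
    simp
  rw [discreteInner_eq_inner hw, hb, hb, ← Submodule.coe_inner]
  exact orthonormal_iff_ite.1 b.orthonormal g h

/-- The discrete Fourier sum `ω ↦ ∑ h, (ω, η_h) η_h`. -/
noncomputable def fourierSum (T : Fin m → TestForm n k E →ₗ[ℝ] ℝ) (w : Fin m → ℝ)
    (η : Module.Basis (Fin N) ℝ V) : TestForm n k E →ₗ[ℝ] TestForm n k E :=
  ∑ h, (∑ i, (w i * T i (η h)) • T i).smulRight (η h : TestForm n k E)

theorem fourierSum_apply (η : Module.Basis (Fin N) ℝ V) (ω : TestForm n k E) :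
    fourierSum T w η ω = ∑ h, discreteInner T w ω (η h) • (η h : TestForm n k E) := by
  simp only [fourierSum, LinearMap.sum_apply, LinearMap.smulRight_apply, LinearMap.smul_apply,
    smul_eq_mul, discreteInner]
  refine Finset.sum_congr rfl fun h _ => ?_
  congr 1
  exact Finset.sum_congr rfl fun i _ => by ring

theorem fourierSum_mem (η : Module.Basis (Fin N) ℝ V) (ω : TestForm n k E) :
    fourierSum T w η ω ∈ V := by
  rw [fourierSum_apply]
  exact V.sum_mem fun h _ => V.smul_mem _ (η h).2

theorem inner_sampling_sub_fourierSum (hw : ∀ i, 0 < w i) {η : Module.Basis (Fin N) ℝ V}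
    (hη : IsDiscreteOrthonormal T w η) (ω : TestForm n k E) {θ : TestForm n k E} (hθ : θ ∈ V) :
    inner ℝ (sampling T w (ω - fourierSum T w η ω)) (sampling T w θ) = 0 := by
  have hbasis : ∀ g, inner ℝ (sampling T w (ω - fourierSum T w η ω)) (sampling T w (η g)) = 0 :=
    fun g => by
      have hg : ∀ h, inner ℝ (sampling T w (η h)) (sampling T w (η g)) =
          if h = g then (1 : ℝ) else 0 := fun h => by
        rw [← discreteInner_eq_inner hw]
        exact hη h g
      rw [map_sub, inner_sub_left, fourierSum_apply, map_sum, sum_inner]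
      simp [real_inner_smul_left, hg, discreteInner_eq_inner hw]
  have hrepr : θ = ∑ g, η.repr ⟨θ, hθ⟩ g • (η g : TestForm n k E) := by
    have := congrArg V.subtype (η.sum_repr ⟨θ, hθ⟩)
    rw [map_sum] at this
    exact this.symm
  rw [hrepr, map_sum, inner_sum]
  refine Finset.sum_eq_zero fun g _ => ?_
  rw [map_smul, real_inner_smul_right, hbasis, mul_zero]

/-- The residual of the Fourier sum is orthogonal to `V`, so Pythagoras separates the error of any
competitor into a fixed part and its distance to the Fourier sum. Uniqueness holds because sampling
is injective on `V`. -/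
theorem isLeastSquaresFit_iff (hw : ∀ i, 0 < w i) (hdet : IsDetermining V T)
    {η : Module.Basis (Fin N) ℝ V} (hη : IsDiscreteOrthonormal T w η) (ω φ : TestForm n k E) :
    IsLeastSquaresFit V T w ω φ ↔ φ = fourierSum T w η ω := by
  have hpyth : ∀ θ ∈ V, discreteInner T w (ω - θ) (ω - θ) =
      ‖sampling T w (ω - fourierSum T w η ω)‖ ^ 2 +
        ‖sampling T w (fourierSum T w η ω - θ)‖ ^ 2 := fun θ hθ => by
    rw [discreteInner_self hw, ← sub_add_sub_cancel ω (fourierSum T w η ω) θ, map_add,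
      norm_add_sq_real, inner_sampling_sub_fourierSum hw hη ω (V.sub_mem (fourierSum_mem η ω) hθ)]
    ring
  constructor
  · rintro ⟨hφ, hmin⟩
    have h := hmin _ (fourierSum_mem (T := T) (w := w) η ω)
    rw [hpyth φ hφ, hpyth _ (fourierSum_mem η ω), sub_self, map_zero, norm_zero] at h
    have h0 : sampling T w (fourierSum T w η ω - φ) = 0 := by
      rw [← norm_eq_zero, ← sq_eq_zero_iff]
      exact le_antisymm (by linarith) (sq_nonneg _)
    exact (sub_eq_zero.1 (eq_zero_of_sampling_eq_zero hw hdet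
      (V.sub_mem (fourierSum_mem η ω) hφ) h0)).symm
  · rintro rfl
    refine ⟨fourierSum_mem η ω, fun θ hθ => ?_⟩
    rw [hpyth θ hθ, discreteInner_self hw]
    exact le_add_of_nonneg_right (sq_nonneg _)

/-- This form isolates the data `T i ω` from coefficients independent of `ω`; both norm estimates
start from it. -/
theorem apply_fourierSum (η : Module.Basis (Fin N) ℝ V) (T' : TestForm n k E →ₗ[ℝ] ℝ)
    (ω : TestForm n k E) : T' (fourierSum T w η ω) =
      ∑ i, w i * T i ω * ∑ h, T i (η h : TestForm n k E) * T' (η h : TestForm n k E) := by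
  simp only [fourierSum_apply, map_sum, map_smul, smul_eq_mul, discreteInner, Finset.sum_mul,
    Finset.mul_sum]
  rw [Finset.sum_comm]
  exact Finset.sum_congr rfl fun i _ => Finset.sum_congr rfl fun h _ => by ring

end LeastSquares

/-! ### The operator norm and the fitting constant. -/

section Norms

variable {n k m N : ℕ} {E : TopologicalSpace.Compacts (Space n)}

theorem norm0_eq (ω : TestForm n k E) : norm0 ω =
    ⨆ S : OrientedRectifiable n k (E : Set (Space n)),
      ENNReal.ofReal |averagingCurrent S ω| := by
  refine iSup_congr fun S => congrArg _ ?_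
  change _ = |(μHE[k] S.carrier).toReal⁻¹ * integral S ω|
  rw [abs_mul, abs_inv, abs_of_pos S.measureReal_pos]

theorem ofReal_abs_averagingCurrent_le_norm0 (S : OrientedRectifiable n k (E : Set (Space n)))
    (ω : TestForm n k E) : ENNReal.ofReal |averagingCurrent S ω| ≤ norm0 ω := by
  rw [norm0_eq]
  exact le_iSup (fun S => ENNReal.ofReal |averagingCurrent S ω|) S

theorem norm0_le_ofReal {ω : TestForm n k E} {C : ℝ} (hC : ∀ x, ‖ω x‖ ≤ C) :
    norm0 ω ≤ ENNReal.ofReal C := by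
  rw [norm0_eq]
  exact iSup_le fun S => ENNReal.ofReal_le_ofReal (abs_averagingCurrent_le S ω hC)

theorem norm0_lt_top (ω : TestForm n k E) : norm0 ω < ⊤ :=
  (norm0_le_ofReal fun x => ω.norm_coe_le_norm x).trans_lt ENNReal.ofReal_lt_top

variable {T : Fin m → TestForm n k E →ₗ[ℝ] ℝ} {w : Fin m → ℝ} {V : Submodule ℝ (TestForm n k E)}

theorem le_fittingConstant (η : Module.Basis (Fin N) ℝ V)
    (S : OrientedRectifiable n k (E : Set (Space n))) :
    ENNReal.ofReal (∑ i, w i * |∑ h, T i (η h : TestForm n k E) *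
      averagingCurrent S (η h : TestForm n k E)|) ≤ fittingConstant T w η :=
  le_iSup₂_of_le (averagingCurrent S) (mem_range_self S) le_rfl

/-- Averages of a form never exceed its sup norm, so `|T' (η h)| ≤ ‖η h‖` uniformly in `T'`. -/
theorem fittingConstant_lt_top (hw : ∀ i, 0 < w i) (η : Module.Basis (Fin N) ℝ V) :
    fittingConstant T w η < ⊤ := by
  refine lt_of_le_of_lt (iSup₂_le ?_) (ENNReal.ofReal_lt_top
    (r := ∑ i, w i * ∑ h, |T i (η h : TestForm n k E)| * ‖(η h : TestForm n k E)‖))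
  rintro _ ⟨S, rfl⟩
  refine ENNReal.ofReal_le_ofReal (Finset.sum_le_sum fun i _ =>
    mul_le_mul_of_nonneg_left ?_ (hw i).le)
  refine (Finset.abs_sum_le_sum_abs _ _).trans (Finset.sum_le_sum fun h _ => ?_)
  rw [abs_mul]
  exact mul_le_mul_of_nonneg_left
    (abs_averagingCurrent_le S _ fun x => ContinuousMap.norm_coe_le_norm _ x) (abs_nonneg _)

theorem opNorm_fourierSum_le (hT : ∀ i, T i ∈ averagingCurrents n k E) (hw : ∀ i, 0 < w i)
    (η : Module.Basis (Fin N) ℝ V) : opNorm (fourierSum T w η) ≤ fittingConstant T w η := by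
  refine iSup₂_le fun ω hω => ENNReal.div_le_of_le_mul ?_
  rw [norm0_eq (fourierSum T w η ω)]
  refine iSup_le fun S => ?_
  have hTω : ∀ i, |T i ω| ≤ (norm0 ω).toReal := fun i => by
    obtain ⟨S', hS'⟩ := hT i
    rw [← hS', ← ENNReal.ofReal_le_iff_le_toReal (norm0_lt_top ω).ne]
    exact ofReal_abs_averagingCurrent_le_norm0 S' ω
  have hle : |averagingCurrent S (fourierSum T w η ω)| ≤
      (∑ i, w i * |∑ h, T i (η h : TestForm n k E) *
        averagingCurrent S (η h : TestForm n k E)|) * (norm0 ω).toReal := by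
    rw [apply_fourierSum, Finset.sum_mul]
    refine (Finset.abs_sum_le_sum_abs _ _).trans (Finset.sum_le_sum fun i _ => ?_)
    rw [abs_mul, abs_mul, abs_of_pos (hw i), mul_right_comm]
    exact mul_le_mul_of_nonneg_left (hTω i) (mul_nonneg (hw i).le (abs_nonneg _))
  calc ENNReal.ofReal |averagingCurrent S (fourierSum T w η ω)|
      ≤ ENNReal.ofReal (∑ i, w i * |∑ h, T i (η h : TestForm n k E) *
        averagingCurrent S (η h : TestForm n k E)|) * ENNReal.ofReal (norm0 ω).toReal := by
        rw [← ENNReal.ofReal_mul' ENNReal.toReal_nonneg]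
        exact ENNReal.ofReal_le_ofReal hle
    _ ≤ fittingConstant T w η * norm0 ω := by
        rw [ENNReal.ofReal_toReal (norm0_lt_top ω).ne]
        exact mul_le_mul_left (le_fittingConstant η S) _

/-- For a fixed current of `S'`, a form almost attaining the signs of the coefficients `c i` on the
`T i` makes every term of the kernel formula almost `w i * |c i|`; then `ε → 0`. -/
theorem fittingConstant_le_opNorm (hT : ∀ i, T i ∈ averagingCurrents n k E) (hw : ∀ i, 0 < w i)
    (η : Module.Basis (Fin N) ℝ V)
    (hsupp : ∀ i j, i ≠ j → μHE[k] (currentSupport (T i) ∩ currentSupport (T j)) = 0) :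
    fittingConstant T w η ≤ opNorm (fourierSum T w η) := by
  choose S hS using hT
  obtain rfl : (fun i => averagingCurrent (S i)) = T := funext hS
  refine iSup₂_le ?_
  rintro _ ⟨S', rfl⟩
  set c : Fin m → ℝ := fun i => ∑ h, averagingCurrent (S i) (η h : TestForm n k E) *
    averagingCurrent S' (η h : TestForm n k E) with hc
  -- A sample `i₀` is needed to see that the test form has nonzero norm; without samples the sum to
  -- be bounded is zero.
  rcases isEmpty_or_nonempty (Fin m) with hm | ⟨⟨i₀⟩⟩
  · simp
  by_cases htop : opNorm (fourierSum (fun i => averagingCurrent (S i)) w η) = ⊤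
  · rw [htop]
    exact le_top
  rw [ENNReal.ofReal_le_iff_le_toReal htop]
  set q := (opNorm (fourierSum (fun i => averagingCurrent (S i)) w η)).toReal with hq
  have key : ∀ ε : ℝ, 0 < ε → ε < 1 → (1 - ε) * ∑ i, w i * |c i| ≤ q := fun ε hε hε1 => by
    obtain ⟨ω, hω1, hω⟩ := exists_form_almost_sign S hsupp (fun i => if 0 ≤ c i then 1 else -1)
      (fun i => by split_ifs <;> simp) hε
    have hne : norm0 ω ≠ 0 := by
      refine (lt_of_lt_of_le (ENNReal.ofReal_pos.2 ?_)
        (ofReal_abs_averagingCurrent_le_norm0 (S i₀) ω)).ne'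
      have h := hω i₀
      refine abs_pos.2 fun h0 => ?_
      rw [h0, mul_zero] at h
      linarith
    have hle1 : norm0 ω ≤ 1 := by simpa using norm0_le_ofReal hω1
    have hval : (1 - ε) * ∑ i, w i * |c i| ≤
        averagingCurrent S' (fourierSum (fun i => averagingCurrent (S i)) w η ω) := by
      rw [apply_fourierSum, Finset.mul_sum]
      refine Finset.sum_le_sum fun i _ => ?_
      have hsign : w i * averagingCurrent (S i) ω * c i =
          ((if 0 ≤ c i then 1 else -1) * averagingCurrent (S i) ω) * (w i * |c i|) := by
        split_ifs with h
        · rw [abs_of_nonneg h]; ring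
        · rw [abs_of_neg (not_le.1 h)]; ring
      change _ ≤ w i * averagingCurrent (S i) ω * c i
      rw [hsign]
      exact mul_le_mul_of_nonneg_right (hω i) (mul_nonneg (hw i).le (abs_nonneg _))
    rw [hq, ← ENNReal.ofReal_le_iff_le_toReal htop]
    calc ENNReal.ofReal ((1 - ε) * ∑ i, w i * |c i|)
        ≤ norm0 (fourierSum (fun i => averagingCurrent (S i)) w η ω) :=
          (ENNReal.ofReal_le_ofReal (hval.trans (le_abs_self _))).trans
            (ofReal_abs_averagingCurrent_le_norm0 S' _)
      -- Comass at most one gives `‖ω‖₀ ≤ 1`, so dividing by it can only increase the value.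
      _ ≤ norm0 (fourierSum (fun i => averagingCurrent (S i)) w η ω) / norm0 ω := by
          simpa using ENNReal.div_le_div_left hle1
            (norm0 (fourierSum (fun i => averagingCurrent (S i)) w η ω))
      _ ≤ _ := le_iSup₂_of_le ω hne le_rfl
  have hlim : Filter.Tendsto (fun ε : ℝ => (1 - ε) * ∑ i, w i * |c i|) (𝓝[>] 0)
      (𝓝 ((1 - 0) * ∑ i, w i * |c i|)) :=
    (Continuous.tendsto (by fun_prop) 0).mono_left nhdsWithin_le_nhds
  rw [sub_zero, one_mul] at hlim
  refine le_of_tendsto hlim ?_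
  filter_upwards [Ioo_mem_nhdsGT (show (0 : ℝ) < 1 from zero_lt_one)] with ε hε
  exact key ε hε.1 hε.2

end Norms

end IntegralCurrents

open IntegralCurrents in
theorem mainTheorem2 {n k : ℕ} (hk : k ≤ n) (E : TopologicalSpace.Compacts (Space n))
    (Ω : Set (Space n)) (hΩ : IsBoundedLipschitzDomain Ω) (hE : (E : Set (Space n)) = closure Ω)
    (V : Submodule ℝ (TestForm n k E)) [FiniteDimensional ℝ V]
    {m : ℕ} (T : Fin m → TestForm n k E →ₗ[ℝ] ℝ) (hT : ∀ i, T i ∈ averagingCurrents n k E)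
    (hdet : IsDetermining V T) (w : Fin m → ℝ) (hw : ∀ i, 0 < w i) :
    ∃ P : TestForm n k E →ₗ[ℝ] TestForm n k E,
      (∀ ω φ, IsLeastSquaresFit V T w ω φ ↔ φ = P ω) ∧
      (∃ η : Module.Basis (Fin (Module.finrank ℝ V)) ℝ V, IsDiscreteOrthonormal T w η) ∧
      ∀ η : Module.Basis (Fin (Module.finrank ℝ V)) ℝ V, IsDiscreteOrthonormal T w η →
        fittingConstant T w η < ⊤ ∧
        opNorm P ≤ fittingConstant T w η ∧
        ((∀ i j, i ≠ j → μHE[k] (currentSupport (T i) ∩ currentSupport (T j)) = 0) →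
          opNorm P = fittingConstant T w η) := by
  obtain ⟨η₀, hη₀⟩ := exists_isDiscreteOrthonormal hw hdet
  refine ⟨fourierSum T w η₀, isLeastSquaresFit_iff hw hdet hη₀, ⟨η₀, hη₀⟩, fun η hη => ?_⟩
  -- Both Fourier sums are the unique minimizer, so the operator does not depend on the orthonormal
  -- basis.
  have hP : fourierSum T w η₀ = fourierSum T w η := LinearMap.ext fun ω =>
    (isLeastSquaresFit_iff hw hdet hη ω _).1 ((isLeastSquaresFit_iff hw hdet hη₀ ω _).2 rfl)
  rw [hP]
  exact ⟨fittingConstant_lt_top hw η, opNorm_fourierSum_le hT hw η, fun hsupp =>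
    le_antisymm (opNorm_fourierSum_le hT hw η) (fittingConstant_le_opNorm hT hw η hsupp)⟩
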